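/- Let $q\in\mathbb C$ with $0<|q|<1$, let $r\ge 2$ be an integer, and put $p=q^{r-1}$, $\epsilon=(-1)^{r-1}$. Write $(a;q)_n=\prod_{i=0}^{n-1}(1-aq^i)$, $(a;q)_\infty=\prod_{i\ge0}(1-aq^i)$, $\theta_q(x)=\sum_{n\in\mathbb Z}q^{n(n-1)/2}x^n$, $[a;q]=\{aq^k: k\in\mathbb Z\}$, and $${}_m\varphi_s(a_1,\dots,a_m;b_1,\dots,b_s;q,x)=\sum_{n\ge0}\frac{(a_1;q)_n\cdots(a_m;q)_n}{(b_1;q)_n\cdots(b_s;q)_n\,(q;q)_n}\left\{(-1)^nq^{n(n-1)/2}\right\}^{1+s-m}x^n .$$ For a formal power series $f(x)=\sum_{n\ge0}a_nx^n$, the $q$-Borel transform of level $r-1$ is $(\mathcal B_p^+f)(\xi)=\sum_{n\ge0}a_n\,p^{n(n-1)/2}\xi^n$. If this series converges near $\xi=0$ and has a meromorphic continuation $\varphi$ to $\mathbb C$ without poles on $[\lambda;p]$, the level-$(r-1)$ resummation of $f$ is $$(\mathcal L^+_{p,\lambda}\varphi)(x)=\sum_{n\in\mathbb Z}\frac{\varphi(\lambda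 p^n)}{\theta_p(\lambda p^n/x)} .$$ Let $\lambda,x\in\mathbb C^*$ with $x\notin[-\lambda;p]$, and for $0\le j\le r-1$ put $$e_j=\tfrac{(r-1)(r-2)}2-(r-1)j,\qquad \Phi_j(z)={}_{r-1}\varphi_{r-1}\bigl(0,\dots,0;\,q^{j+1},\dots,\widehat{q^{\,r}},\dots,q^{j+r};\,q^r,z\bigr),$$ where the hat means that $q^r$ is omitted from the list $q^{j+1},q^{j+2},\dots,q^{j+r}$. Then every series $\Phi_j(z)$ converges for all $z\in\mathbb C$, and the following hold; in each case the resummation exists, i.e. the continuation $\varphi$ exists without poles on $[\lambda;p]$, no $\theta_p(\lambda p^n/x)$ vanishes, and the Laplace sum converges (unconditionally). (i) If $\lambda\notin[\epsilon;q]$, the level-$(r-1)$ resummation of the series ${}_r\varphi_0(0,\dots,0;-;q,x)$ equals $$\sum_{j=0}^{r-1}\frac{(q;q)_\infty\;\theta_{q^{r(r-1)}}\!\left(q^{e_j}\lambda^r/x\right)}{\theta_{q^{r-1}}(\lambda/x)\,\theta_q(-\epsilon\lambda)}\;\frac{(-\epsilon)^{j}q^{j(j-1)/2}}{(q;q)_j}\left(\frac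 q\lambda\right)^{j}\Phi_j\!\left(\frac{\epsilon\,q^{j+1}}{x}\right).$$ (ii) If $\lambda\notin q^{\mathbb Z}$, the level-$(r-1)$ resummation of the series ${}_r\varphi_0(0,\dots,0;-;q,\epsilon x)$ (as a power series in $x$) equals $$\sum_{j=0}^{r-1}\frac{(q;q)_\infty\;\theta_{q^{r(r-1)}}\!\left((-1)^{r-1}q^{e_j}\lambda^r/x\right)}{\theta_{q^{r-1}}(\lambda/x)\,\theta_q(-\lambda)}\;\frac{(-1)^{j}q^{j(j-1)/2}}{(q;q)_j}\left(\frac q\lambda\right)^{j}\Phi_j\!\left(\frac{q^{j+1}}{x}\right).$$ -/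

import Mathlib

open Filter Topology

noncomputable section

/-- The `q`-shifted factorial `(a;q)_n = (1 - a)(1 - a q) ⋯ (1 - a q^(n-1))`. -/
def qPoch (a q : ℂ) (n : ℕ) : ℂ := ∏ i ∈ Finset.range n, (1 - a * q ^ i)

/-- The infinite product `(a;q)_∞` (used for `‖q‖ < 1`, where it converges absolutely). -/
def qPochInf (a q : ℂ) : ℂ := ∏' i : ℕ, (1 - a * q ^ i)

/-- Jacobi's theta function with base `q`:
`θ_q(x) = ∑_{n ∈ ℤ} q^(n(n-1)/2) x^n`; the integer division in the exponent is exact. -/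
def qTheta (q x : ℂ) : ℂ := ∑' n : ℤ, q ^ (n * (n - 1) / 2) * x ^ n

/-- The `q`-spiral `[a;q] = {a q^k ; k ∈ ℤ}`. -/
def qSpiral (a q : ℂ) : Set ℂ := {z | ∃ k : ℤ, z = a * q ^ k}

/-- The `n`-th coefficient of the basic hypergeometric series with upper parameters `a`,
lower parameters `b` and base `q`. -/
def qHypCoeff (a b : List ℂ) (q : ℂ) (n : ℕ) : ℂ :=
  (a.map fun c => qPoch c q n).prod / ((b.map fun c => qPoch c q n).prod * qPoch q q n) *
    ((-1) ^ n * q ^ (n * (n - 1) / 2)) ^ (1 + (b.length : ℤ) - (a.length : ℤ))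

/-- The basic hypergeometric series as a formal power series in `x`. -/
def qHypSeries (a b : List ℂ) (q : ℂ) : PowerSeries ℂ := PowerSeries.mk (qHypCoeff a b q)

/-- The sum of the basic hypergeometric series at `x` (where it converges). -/
def qHyp (a b : List ℂ) (q x : ℂ) : ℂ := ∑' n : ℕ, qHypCoeff a b q n * x ^ n

/-- The (formal) `p`-Borel transformation `∑ aₙ xⁿ ↦ ∑ aₙ p^(n(n-1)/2) ξⁿ`.
Level `r - 1` is the case `p = q^(r-1)`. -/
def qBorel (p : ℂ) (f : PowerSeries ℂ) : PowerSeries ℂ :=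
  PowerSeries.mk fun n => PowerSeries.coeff n f * p ^ (n * (n - 1) / 2)

/-- `φ` is a meromorphic function on `ℂ` whose expansion at the origin is `F`. -/
def IsMeromorphicSumOf (F : PowerSeries ℂ) (φ : ℂ → ℂ) : Prop :=
  MeromorphicOn φ Set.univ ∧
    ∀ᶠ ξ in 𝓝 (0 : ℂ), HasSum (fun n : ℕ => PowerSeries.coeff n F * ξ ^ n) (φ ξ)

/-- The `p`-Laplace transform of `φ` along the spiral `[lam;p]` converges at `x` to `S`:
`S = ∑_{n ∈ ℤ} φ(lam pⁿ) / θ_p(lam pⁿ / x)`. Level `r - 1` is the case `p = q^(r-1)`. -/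
def HasQLaplace (p lam : ℂ) (φ : ℂ → ℂ) (x S : ℂ) : Prop :=
  HasSum (fun n : ℤ => φ (lam * p ^ n) / qTheta p (lam * p ^ n / x)) S

/-- The `p`-Borel-Laplace resummation of the formal power series `f` along `[lam;p]` is defined
at `x` and has the value `S`: the Borel transform of `f` converges near the origin, extends to a
meromorphic function `φ` on `ℂ` without poles on `[lam;p]`, no term of the Laplace transform has
a vanishing denominator, and the Laplace transform of `φ` converges at `x` to `S`. -/
def HasBorelLaplaceSum (p lam : ℂ) (f : PowerSeries ℂ) (x S : ℂ) : Prop :=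
  ∃ φ : ℂ → ℂ, IsMeromorphicSumOf (qBorel p f) φ ∧
    (∀ n : ℤ, AnalyticAt ℂ φ (lam * p ^ n)) ∧
    (∀ n : ℤ, qTheta p (lam * p ^ n / x) ≠ 0) ∧
    HasQLaplace p lam φ x S

/-- The meromorphic continuation is determined by the series away from poles. -/
theorem IsMeromorphicSumOf.eq_at {F : PowerSeries ℂ} {φ ψ : ℂ → ℂ}
    (h1 : IsMeromorphicSumOf F φ) (h2 : IsMeromorphicSumOf F ψ) {z : ℂ}
    (a1 : AnalyticAt ℂ φ z) (a2 : AnalyticAt ℂ ψ z) : φ z = ψ z := by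
  have hm : MeromorphicOn (φ - ψ) Set.univ := h1.1.sub h2.1
  have h0 : meromorphicOrderAt (φ - ψ) 0 = ⊤ := by
    rw [meromorphicOrderAt_eq_top_iff]
    refine Filter.Eventually.filter_mono nhdsWithin_le_nhds ?_
    filter_upwards [h1.2, h2.2] with ξ e1 e2
    simp [e1.unique e2]
  have hz : meromorphicOrderAt (φ - ψ) z = ⊤ := by
    by_contra hne
    exact hm.meromorphicOrderAt_ne_top_of_isPreconnected isPreconnected_univ
      (Set.mem_univ z) (Set.mem_univ 0) hne h0
  rw [meromorphicOrderAt_eq_top_iff] at hz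
  have hc : ContinuousAt (φ - ψ) z := (a1.sub a2).continuousAt
  have hl : Tendsto (φ - ψ) (𝓝[≠] z) (𝓝 ((φ - ψ) z)) :=
    hc.tendsto.mono_left nhdsWithin_le_nhds
  have hl0 : Tendsto (φ - ψ) (𝓝[≠] z) (𝓝 0) :=
    tendsto_const_nhds.congr' (hz.mono fun _ h => h.symm)
  have := tendsto_nhds_unique hl hl0
  simpa [sub_eq_zero] using this

/-- The value of the resummation is unique. -/
theorem HasBorelLaplaceSum.unique {p lam x S T : ℂ} {f : PowerSeries ℂ}
    (h1 : HasBorelLaplaceSum p lam f x S) (h2 : HasBorelLaplaceSum p lam f x T) : S = T := by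
  obtain ⟨φ, m1, a1, -, s1⟩ := h1
  obtain ⟨ψ, m2, a2, -, s2⟩ := h2
  have e : ∀ n : ℤ, φ (lam * p ^ n) = ψ (lam * p ^ n) := fun n => m1.eq_at m2 (a1 n) (a2 n)
  unfold HasQLaplace at s1 s2
  simp only [e] at s1
  exact s1.unique s2

end

/-! Put `s = r - 1` and `a = σλ`, with `σ = ε` in (i) and `σ = 1` in (ii). The Borel factor cancels
the powers of `q` in the coefficients and leaves `∑ (σξ)^n / (q;q)_n`, which by Euler is `1 /
(σξ;q)_∞`, meromorphic on `ℂ`.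

At `ξ = λ p^n` the triple product and the quasi-periodicity of theta turn this value into an
explicit monomial times `(q^(1-sn)/a; q)_∞`, which Euler's other series expands in powers indexed by
`k`. With the quasi-periodicity of `θ_p`, the Laplace sum becomes a double series over `(n, k) ∈ ℤ ×
ℕ`.

Writing `k = j + (s+1)m` with `0 ≤ j ≤ s` and replacing `n` by `n + m` removes the cross term of the
quadratic exponent (`laplaceTerm_shear`). Each residue class `j` then factors into a theta series in
`n` times `Φ_j` in `m`. Both factors converge absolutely, so the double series does too, and summing
it over `k` first returns the Laplace sum. -/

theorem summable_of_succ_eq_mul {u d : ℕ → ℂ} (h : ∀ n, u (n + 1) = d n * u n)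
    (hd : Tendsto d atTop (𝓝 0)) : Summable u := by
  refine summable_of_ratio_norm_eventually_le (r := 1 / 2) (by norm_num) ?_
  have h1 : ∀ᶠ n in atTop, ‖d n‖ < 1 / 2 := by
    have := hd.norm
    rw [norm_zero] at this
    exact this.eventually (gt_mem_nhds (by norm_num))
  filter_upwards [h1] with n hn
  rw [h, norm_mul]
  gcongr

theorem two_mul_triangular (n : ℤ) : 2 * (n * (n - 1) / 2) = n * (n - 1) :=
  Int.mul_ediv_cancel' (Int.even_mul_pred_self n).two_dvd

theorem natCast_triangular (n : ℕ) : ((n * (n - 1) / 2 : ℕ) : ℤ) = (n : ℤ) * (n - 1) / 2 := by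
  cases n <;> simp

theorem triangular_succ (n : ℕ) : (n + 1) * (n + 1 - 1) / 2 = n * (n - 1) / 2 + n := by
  rw [← @Nat.cast_inj ℤ, Nat.cast_add, natCast_triangular, natCast_triangular]
  have h1 := two_mul_triangular n
  have h2 := two_mul_triangular (n + 1 : ℕ)
  push_cast at *
  linarith

theorem tendsto_pow_zero_of_norm_lt_one {q : ℂ} (hq1 : ‖q‖ < 1) :
    Tendsto (fun n : ℕ => q ^ n) atTop (𝓝 0) := tendsto_pow_atTop_nhds_zero_of_norm_lt_one hq1

/-! ### `q`-shifted factorials -/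

theorem qPoch_succ (a q : ℂ) (n : ℕ) : qPoch a q (n + 1) = qPoch a q n * (1 - a * q ^ n) :=
  Finset.prod_range_succ _ _

theorem qPoch_add (a q : ℂ) (m n : ℕ) :
    qPoch a q (m + n) = qPoch a q m * ∏ i ∈ Finset.range n, (1 - a * q ^ (m + i)) :=
  Finset.prod_range_add _ _ _

theorem summable_norm_mul_pow {q : ℂ} (hq1 : ‖q‖ < 1) (a : ℂ) :
    Summable fun n : ℕ => ‖-(a * q ^ n)‖ := by
  simp only [norm_neg, norm_mul, norm_pow]
  exact (summable_geometric_of_lt_one (norm_nonneg _) hq1).mul_left _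

theorem multipliable_one_sub_mul_pow {q : ℂ} (hq1 : ‖q‖ < 1) (a : ℂ) :
    Multipliable fun n : ℕ => 1 - a * q ^ n := by
  simpa [sub_eq_add_neg] using multipliable_one_add_of_summable (summable_norm_mul_pow hq1 a)

theorem tendsto_qPoch {q : ℂ} (hq1 : ‖q‖ < 1) (a : ℂ) :
    Tendsto (qPoch a q) atTop (𝓝 (qPochInf a q)) :=
  (multipliable_one_sub_mul_pow hq1 a).hasProd.tendsto_prod_nat

theorem qPochInf_ne_zero {q a : ℂ} (hq1 : ‖q‖ < 1) (h : ∀ n : ℕ, a * q ^ n ≠ 1) :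
    qPochInf a q ≠ 0 := by
  have := tprod_one_add_ne_zero_of_summable (f := fun n : ℕ => -(a * q ^ n))
    (fun n hn => h n (by linear_combination -hn)) (summable_norm_mul_pow hq1 a)
  simpa [qPochInf, sub_eq_add_neg] using this

theorem qPochInf_eq_one_sub_mul {q : ℂ} (hq1 : ‖q‖ < 1) (a : ℂ) :
    qPochInf a q = (1 - a) * qPochInf (a * q) q := by
  refine tendsto_nhds_unique ((tendsto_add_atTop_iff_nat 1).2 (tendsto_qPoch hq1 a)) ?_
  refine ((tendsto_qPoch hq1 (a * q)).const_mul (1 - a)).congr fun n => ?_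
  simp only [qPoch, Finset.prod_range_succ' _ n]
  rw [mul_comm]
  simp [pow_succ', mul_assoc]

theorem pow_ne_one_of_norm_lt_one {q : ℂ} (hq1 : ‖q‖ < 1) {n : ℕ} (hn : n ≠ 0) : q ^ n ≠ 1 := by
  intro h
  have := congrArg norm h
  rw [norm_pow, norm_one] at this
  exact (pow_lt_one₀ (norm_nonneg _) hq1 hn).ne this

theorem qPochInf_self_ne_zero {q : ℂ} (hq1 : ‖q‖ < 1) : qPochInf q q ≠ 0 :=
  qPochInf_ne_zero hq1 fun n => by
    rw [← pow_succ']; exact pow_ne_one_of_norm_lt_one hq1 n.succ_ne_zero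

theorem qPoch_self_ne_zero {q : ℂ} (hq1 : ‖q‖ < 1) (n : ℕ) : qPoch q q n ≠ 0 := by
  refine Finset.prod_ne_zero_iff.2 fun i _ h => ?_
  rw [← pow_succ'] at h
  exact pow_ne_one_of_norm_lt_one hq1 i.succ_ne_zero (sub_eq_zero.1 h).symm

/-! ### Euler's two series -/

/-- Supplies the value at the origin when a `q`-difference equation is iterated along `z q^n`. The
terms at `z` dominate all later ones. -/
theorem tendsto_tsum_mul_pow {c : ℕ → ℂ} {z q : ℂ} (hq1 : ‖q‖ < 1)
    (hc : Summable fun k => c k * z ^ k) :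
    Tendsto (fun n : ℕ => ∑' k, c k * (z * q ^ n) ^ k) atTop (𝓝 (c 0)) := by
  have h0 : c 0 = ∑' k, if k = 0 then c 0 else 0 := by simp
  rw [h0]
  refine tendsto_tsum_of_dominated_convergence hc.norm (fun k => ?_)
    (Eventually.of_forall fun n k => ?_)
  · rcases k with _ | k
    · simp
    · have : Tendsto (fun n : ℕ => c (k + 1) * (z * q ^ n) ^ (k + 1)) atTop
          (𝓝 (c (k + 1) * (z * 0) ^ (k + 1))) :=
        (((tendsto_pow_zero_of_norm_lt_one hq1).const_mul z).pow (k + 1)).const_mul _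
      simpa using this
  · rw [mul_pow, ← mul_assoc, norm_mul]
    refine mul_le_of_le_one_right (norm_nonneg _) ?_
    rw [norm_pow, norm_pow]
    exact pow_le_one₀ (by positivity) (pow_le_one₀ (norm_nonneg _) hq1.le)

/-- Comparing coefficients gives `g(zq) = (1 - z) g(z)` for the sum `g`. Iterating and letting `z
q^n → 0` yields `g(z) (z;q)_∞ = g(0) = 1`. -/
theorem hasSum_inv_qPoch {q z : ℂ} (hq1 : ‖q‖ < 1) (hz : ‖z‖ < 1) :
    HasSum (fun n : ℕ => (qPoch q q n)⁻¹ * z ^ n) (qPochInf z q)⁻¹ := by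
  have hs : ∀ z : ℂ, ‖z‖ < 1 → Summable fun n : ℕ => (qPoch q q n)⁻¹ * z ^ n := fun z hz => by
    -- The coefficients converge, hence are bounded, so a geometric series dominates.
    have hb : Tendsto (fun n => (qPoch q q n)⁻¹) atTop (𝓝 (qPochInf q q)⁻¹) :=
      (tendsto_qPoch hq1 q).inv₀ (qPochInf_self_ne_zero hq1)
    obtain ⟨C, hC⟩ := hb.norm.bddAbove_range
    refine Summable.of_norm_bounded
      ((summable_geometric_of_lt_one (norm_nonneg z) hz).mul_left C) fun n => ?_
    rw [norm_mul, norm_pow]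
    exact mul_le_mul_of_nonneg_right (hC ⟨n, rfl⟩) (by positivity)
  set g : ℂ → ℂ := fun z => ∑' n : ℕ, (qPoch q q n)⁻¹ * z ^ n with hg
  have hstep : ∀ z : ℂ, ‖z‖ < 1 → g (z * q) = g z * (1 - z) := fun z hz => by
    have hzq : ‖z * q‖ < 1 := by
      rw [norm_mul]; exact mul_lt_one_of_nonneg_of_lt_one_left (norm_nonneg _) hz hq1.le
    have h1 : g z - g (z * q) = z * g z := by
      simp only [hg]
      rw [← (hs z hz).tsum_sub (hs _ hzq), ((hs z hz).sub (hs _ hzq)).tsum_eq_zero_add,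
        ← tsum_mul_left]
      simp only [pow_zero, mul_one, sub_self, zero_add]
      refine tsum_congr fun n => ?_
      have h2 := qPoch_self_ne_zero hq1 (n + 1)
      rw [qPoch_succ] at h2 ⊢
      have h3 := left_ne_zero_of_mul h2
      have h4 := right_ne_zero_of_mul h2
      field_simp
      ring
    linear_combination -h1
  have hiter : ∀ n : ℕ, g (z * q ^ n) = g z * qPoch z q n := fun n => by
    induction n with
    | zero => simp [qPoch]
    | succ n ih =>
      rw [pow_succ, ← mul_assoc, hstep, ih, qPoch_succ, mul_assoc]
      rw [norm_mul, norm_pow]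
      exact mul_lt_one_of_nonneg_of_lt_one_left (norm_nonneg _) hz
        (pow_le_one₀ (norm_nonneg _) hq1.le)
  have hlim := tendsto_tsum_mul_pow hq1 (hs z hz)
  have hlim2 : Tendsto (fun n : ℕ => g (z * q ^ n)) atTop (𝓝 (g z * qPochInf z q)) := by
    simp only [hiter]
    exact (tendsto_qPoch hq1 z).const_mul _
  have h1 : g z * qPochInf z q = 1 := by
    have := tendsto_nhds_unique hlim2 hlim
    simpa [qPoch] using this
  rw [← eq_inv_of_mul_eq_one_left h1]
  exact (hs z hz).hasSum

/-- The coefficients of the entire function `z ↦ (z;q)_∞`. -/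
noncomputable def eulerCoeff (q : ℂ) (k : ℕ) : ℂ := (-1) ^ k * q ^ (k * (k - 1) / 2) / qPoch q q k

theorem summable_eulerCoeff {q : ℂ} (hq1 : ‖q‖ < 1) (z : ℂ) :
    Summable fun k : ℕ => eulerCoeff q k * z ^ k := by
  refine summable_of_succ_eq_mul (d := fun n => -z * q ^ n * (1 - q * q ^ n)⁻¹) (fun n => ?_) ?_
  · have h2 := qPoch_self_ne_zero hq1 (n + 1)
    rw [eulerCoeff, eulerCoeff, triangular_succ]
    rw [qPoch_succ] at h2 ⊢
    have h3 := left_ne_zero_of_mul h2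
    have h4 := right_ne_zero_of_mul h2
    field_simp
    ring
  · have h := tendsto_pow_zero_of_norm_lt_one hq1
    have := (h.const_mul (-z)).mul (((h.const_mul q).const_sub 1).inv₀ (by simp))
    simpa using this

/-- Same method, with the equation `h(z) = (1 - z) h(zq)`, now valid on all of `ℂ`. -/
theorem hasSum_eulerCoeff {q : ℂ} (hq1 : ‖q‖ < 1) (z : ℂ) :
    HasSum (fun k : ℕ => eulerCoeff q k * z ^ k) (qPochInf z q) := by
  set h : ℂ → ℂ := fun z => ∑' n : ℕ, eulerCoeff q n * z ^ n with hh
  have hs := summable_eulerCoeff hq1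
  have hstep : ∀ z : ℂ, h z = (1 - z) * h (z * q) := fun z => by
    have h1 : h z - h (z * q) = -z * h (z * q) := by
      simp only [hh]
      rw [← (hs z).tsum_sub (hs _), ((hs z).sub (hs _)).tsum_eq_zero_add, ← tsum_mul_left]
      simp only [pow_zero, mul_one, sub_self, zero_add]
      refine tsum_congr fun n => ?_
      have h2 := qPoch_self_ne_zero hq1 (n + 1)
      rw [eulerCoeff, eulerCoeff, triangular_succ]
      rw [qPoch_succ] at h2 ⊢
      have h3 := left_ne_zero_of_mul h2
      have h4 := right_ne_zero_of_mul h2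
      field_simp
      ring
    linear_combination h1
  have hiter : ∀ n : ℕ, qPoch z q n * h (z * q ^ n) = h z := fun n => by
    induction n with
    | zero => simp [qPoch]
    | succ n ih =>
      rw [← ih, hstep (z * q ^ n), qPoch_succ, pow_succ]
      ring_nf
  have hlim := (tendsto_qPoch hq1 z).mul (tendsto_tsum_mul_pow hq1 (hs z))
  have h1 : h z = qPochInf z q := by
    have := tendsto_nhds_unique (tendsto_const_nhds.congr fun n => (hiter n).symm) hlim
    simpa [eulerCoeff, qPoch] using this
  rw [← h1]
  exact (hs z).hasSum

theorem differentiable_qPochInf {q : ℂ} (hq1 : ‖q‖ < 1) :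
    Differentiable ℂ fun z => qPochInf z q := by
  intro z
  have h : DifferentiableOn ℂ (fun z => ∑' k, eulerCoeff q k * z ^ k)
      (Metric.ball 0 (‖z‖ + 1)) := by
    refine Complex.differentiableOn_tsum_of_summable_norm
      (summable_eulerCoeff hq1 ((‖z‖ + 1 : ℝ) : ℂ)).norm (fun i => by fun_prop)
      Metric.isOpen_ball fun k w hw => ?_
    rw [norm_mul, norm_mul, norm_pow, norm_pow, Complex.norm_real,
      Real.norm_of_nonneg (by positivity)]
    have : ‖w‖ ≤ ‖z‖ + 1 := (by simpa using hw : ‖w‖ < ‖z‖ + 1).le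
    gcongr
  have h2 : (fun z => qPochInf z q) = fun z => ∑' k, eulerCoeff q k * z ^ k :=
    funext fun z => (hasSum_eulerCoeff hq1 z).tsum_eq.symm
  rw [h2]
  exact h.differentiableAt (Metric.isOpen_ball.mem_nhds (by simp))

/-! ### The theta function and the triple product -/

theorem summable_pow_triangular {q : ℂ} (hq1 : ‖q‖ < 1) (y : ℂ) :
    Summable fun n : ℕ => q ^ (n * (n - 1) / 2) * y ^ n := by
  refine summable_of_succ_eq_mul (d := fun n => y * q ^ n) (fun n => ?_) ?_
  · rw [triangular_succ]; ring
  · simpa using (tendsto_pow_zero_of_norm_lt_one hq1).const_mul y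

theorem summable_qTheta {q : ℂ} (hq0 : q ≠ 0) (hq1 : ‖q‖ < 1) (y : ℂ) :
    Summable fun n : ℤ => q ^ (n * (n - 1) / 2) * y ^ n := by
  refine Summable.of_nat_of_neg ?_ ?_
  · refine (summable_pow_triangular hq1 y).congr fun n => ?_
    rw [← natCast_triangular, zpow_natCast, zpow_natCast]
  · refine (summable_pow_triangular hq1 (q / y)).congr fun n => ?_
    have : (-(n : ℤ)) * (-(n : ℤ) - 1) / 2 = ((n * (n - 1) / 2 : ℕ) : ℤ) + n := by
      rw [natCast_triangular]
      have h1 := two_mul_triangular n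
      have h2 := two_mul_triangular (-n)
      linarith
    rw [this, zpow_add₀ hq0, zpow_natCast, zpow_natCast, zpow_neg, zpow_natCast, div_pow]
    ring

theorem qTheta_mul_zpow {q y : ℂ} (hq0 : q ≠ 0) (hy : y ≠ 0) (n : ℤ) :
    q ^ (n * (n - 1) / 2) * y ^ n * qTheta q (y * q ^ n) = qTheta q y := by
  rw [qTheta, qTheta, ← tsum_mul_left,
    ← (Equiv.addRight n).tsum_eq fun m : ℤ => q ^ (m * (m - 1) / 2) * y ^ m]
  refine tsum_congr fun m => ?_
  have : (m + n) * (m + n - 1) / 2 = n * (n - 1) / 2 + (m * (m - 1) / 2 + n * m) := by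
    have h1 := two_mul_triangular n
    have h2 := two_mul_triangular m
    have h3 := two_mul_triangular (m + n)
    linarith
  rw [Equiv.coe_addRight, this, zpow_add₀ hq0, zpow_add₀ hq0, zpow_add₀ hy, mul_zpow, zpow_mul]
  ring

/-- The shear `(n, m) ↦ (n + m, m)` of `ℤ × ℕ`. -/
def intNatShear : ℤ × ℕ ≃ ℤ × ℕ where
  toFun t := (t.1 + t.2, t.2)
  invFun t := (t.1 - t.2, t.2)
  left_inv t := by simp
  right_inv t := by simp

theorem hasSum_mul_of_summable {ι κ : Type*} {f : ι → ℂ} {g : κ → ℂ} (hf : Summable f)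
    (hg : Summable g) : HasSum (fun t : ι × κ => f t.1 * g t.2) ((∑' i, f i) * ∑' k, g k) :=
  hf.hasSum.mul hg.hasSum (summable_mul_of_summable_norm hf.norm hg.norm)

theorem qPochInf_zpow_eq_zero {q : ℂ} (hq0 : q ≠ 0) (n : ℕ) : qPochInf (q ^ (-(n : ℤ))) q = 0 := by
  have : HasProd (fun i : ℕ => 1 - q ^ (-(n : ℤ)) * q ^ i) 0 := by
    refine hasProd_zero_of_exists_eq_zero ⟨n, ?_⟩
    rw [zpow_neg, zpow_natCast, inv_mul_cancel₀ (pow_ne_zero _ hq0), sub_self]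
  exact this.tprod_eq

theorem qPochInf_eq_qPoch_mul {q : ℂ} (hq1 : ‖q‖ < 1) (a : ℂ) (n : ℕ) :
    qPochInf a q = qPoch a q n * qPochInf (a * q ^ n) q := by
  induction n with
  | zero => simp [qPoch]
  | succ n ih => rw [ih, qPochInf_eq_one_sub_mul hq1 (a * q ^ n), qPoch_succ, pow_succ]; ring_nf

/-- Jacobi's triple product identity, near infinity. -/
theorem qTheta_neg_of_norm_lt {q z : ℂ} (hq0 : q ≠ 0) (hq1 : ‖q‖ < 1) (hz0 : z ≠ 0)
    (hz : ‖q / z‖ < 1) :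
    qTheta q (-z) = qPochInf q q * qPochInf z q * qPochInf (q / z) q := by
  set f : ℤ → ℂ := fun n => q ^ (n * (n - 1) / 2) * (-z) ^ n with hf
  have hP := hasSum_mul_of_summable (summable_qTheta hq0 hq1 (-z)) (hasSum_inv_qPoch hq1 hz).summable
  rw [(hasSum_inv_qPoch hq1 hz).tsum_eq] at hP
  -- The product of the theta series and the series of `1 / (q/z;q)_∞`, after the shear. Its sum
  -- over the second index is `f n` times `(q^(n+1);q)_∞`.
  set F : ℤ × ℕ → ℂ := fun t => f t.1 * (eulerCoeff q t.2 * (q ^ (t.1 + 1)) ^ t.2) with hF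
  have hshear : HasSum (F ∘ intNatShear.symm) (qTheta q (-z) * (qPochInf (q / z) q)⁻¹) := by
    refine hP.congr_fun ?_
    rintro ⟨n, m⟩
    have hz0' : -z ≠ 0 := neg_ne_zero.2 hz0
    have h2 : (n - m) * (n - m - 1) / 2 + (m * (m - 1) / 2 + (n - m + 1) * m) =
        n * (n - 1) / 2 + m := by
      have h1 := two_mul_triangular n
      have h2 := two_mul_triangular m
      have h3 := two_mul_triangular (n - m)
      linarith
    have h3 := congrArg (fun e => q ^ e) h2
    rw [zpow_add₀ hq0, zpow_add₀ hq0, zpow_add₀ hq0, zpow_mul q (n - m + 1),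
      ← natCast_triangular m] at h3
    simp only [zpow_natCast] at h3
    simp only [Function.comp, intNatShear, Equiv.coe_fn_symm_mk, hF, hf, eulerCoeff]
    rw [zpow_sub₀ hz0', zpow_natCast, neg_pow z m, div_pow]
    have h4 := qPoch_self_ne_zero hq1 m
    have h5 : ((-1 : ℂ) ^ m) ≠ 0 := by simp
    field_simp
    linear_combination h3
  have h2 : HasSum F (qTheta q (-z) * (qPochInf (q / z) q)⁻¹) :=
    (Equiv.hasSum_iff intNatShear.symm).1 hshear
  have h3 := h2.prod_fiberwise fun n => (hasSum_eulerCoeff hq1 (q ^ (n + 1))).mul_left (f n)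
  -- The factor `(q^(n+1);q)_∞` vanishes for `n < 0` and equals `(q;q)_∞ / (q;q)_n` for `n ≥ 0`,
  -- which leaves Euler's series for `(z;q)_∞`.
  have h4 : HasSum (fun n : ℤ => f n * qPochInf (q ^ (n + 1)) q)
      (qPochInf q q * qPochInf z q) := by
    rw [← Nat.cast_injective.hasSum_iff (f := fun n : ℤ => f n * qPochInf (q ^ (n + 1)) q)]
    · refine ((hasSum_eulerCoeff hq1 z).mul_left (qPochInf q q)).congr_fun fun n => ?_
      have h4 := qPoch_self_ne_zero hq1 n
      have h5 : q ^ ((n : ℤ) + 1) = q * q ^ n := by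
        rw [zpow_add₀ hq0, zpow_natCast, zpow_one, mul_comm]
      simp only [Function.comp, hf, eulerCoeff]
      rw [h5, qPochInf_eq_qPoch_mul hq1 q n, ← natCast_triangular, zpow_natCast, zpow_natCast,
        neg_pow z n]
      field_simp
    · intro n hn
      have hn' : n < 0 := by
        by_contra h
        exact hn ⟨n.toNat, Int.toNat_of_nonneg (not_lt.1 h)⟩
      have h4 : n + 1 = -((-(n + 1)).toNat : ℤ) := by omega
      rw [h4, qPochInf_zpow_eq_zero hq0, mul_zero]
  have h5 := h3.unique h4
  have h6 : qPochInf (q / z) q ≠ 0 := qPochInf_ne_zero hq1 fun n h => by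
    have h7 : ‖q / z * q ^ n‖ < 1 := by
      rw [norm_mul, norm_pow]
      exact mul_lt_one_of_nonneg_of_lt_one_left (norm_nonneg _) hz
        (pow_le_one₀ (norm_nonneg _) hq1.le)
    rw [h, norm_one] at h7
    exact lt_irrefl _ h7
  rw [← h5, inv_mul_cancel_right₀ h6]

/-- Jacobi's triple product identity. -/
theorem qTheta_neg {q z : ℂ} (hq0 : q ≠ 0) (hq1 : ‖q‖ < 1) (hz0 : z ≠ 0) :
    qTheta q (-z) = qPochInf q q * qPochInf z q * qPochInf (q / z) q := by
  -- Both sides obey the same equation under `z ↦ z / q`, so the identity spreads inward from `|z| >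
  -- |q|`, one factor of `q` per step, to every nonzero `z`.
  have key : ∀ (n : ℕ) (z : ℂ), z ≠ 0 → ‖q * q ^ n / z‖ < 1 →
      qTheta q (-z) = qPochInf q q * qPochInf z q * qPochInf (q / z) q := fun n => by
    induction n with
    | zero => intro z hz0 hz; exact qTheta_neg_of_norm_lt hq0 hq1 hz0 (by simpa using hz)
    | succ n ih =>
      intro z hz0 hz
      have h1 := ih (z / q) (div_ne_zero hz0 hq0) (by
        rwa [show q * q ^ n / (z / q) = q * q ^ (n + 1) / z by field_simp; ring])
      have h2 := qTheta_mul_zpow hq0 (neg_ne_zero.2 (div_ne_zero hz0 hq0)) 1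
      rw [h1, qPochInf_eq_one_sub_mul hq1 (z / q), div_mul_cancel₀ _ hq0] at h2
      rw [qPochInf_eq_one_sub_mul hq1 (q / z),
        show q / z * q = q / (z / q) by field_simp]
      have h3 : -(z / q) * q ^ (1 : ℤ) = -z := by rw [zpow_one]; field_simp
      rw [h3] at h2
      norm_num at h2
      field_simp at h2 ⊢
      linear_combination -h2
  have hlim : Tendsto (fun n : ℕ => q * q ^ n / z) atTop (𝓝 0) := by
    simpa using ((tendsto_pow_zero_of_norm_lt_one hq1).const_mul q).div_const z
  have h := hlim.norm
  rw [norm_zero] at h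
  obtain ⟨n, hn⟩ := (h.eventually (gt_mem_nhds one_pos)).exists
  exact key n z hz0 hn

/-! ### Non-vanishing off spirals, and expansion of the Laplace terms -/

theorem qPochInf_ne_zero_of_notMem_qSpiral {q a : ℂ} (hq1 : ‖q‖ < 1)
    (h : a ∉ qSpiral 1 q) : qPochInf a q ≠ 0 :=
  qPochInf_ne_zero hq1 fun n hn => h ⟨-n, by
    rw [zpow_neg, zpow_natCast, one_mul, eq_inv_of_mul_eq_one_left hn]⟩

theorem mul_zpow_notMem_qSpiral {q a b : ℂ} (hq0 : q ≠ 0) (h : a ∉ qSpiral b q) (n : ℤ) :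
    a * q ^ n ∉ qSpiral b q := by
  rintro ⟨k, hk⟩
  refine h ⟨k - n, ?_⟩
  rw [zpow_sub₀ hq0, mul_div_assoc', ← hk, mul_div_cancel_right₀ _ (zpow_ne_zero _ hq0)]

theorem qTheta_neg_ne_zero {q a : ℂ} (hq0 : q ≠ 0) (hq1 : ‖q‖ < 1) (ha0 : a ≠ 0)
    (h : a ∉ qSpiral 1 q) : qTheta q (-a) ≠ 0 := by
  rw [qTheta_neg hq0 hq1 ha0]
  refine mul_ne_zero (mul_ne_zero (qPochInf_self_ne_zero hq1)
    (qPochInf_ne_zero_of_notMem_qSpiral hq1 h))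
    (qPochInf_ne_zero_of_notMem_qSpiral hq1 ?_)
  rintro ⟨k, hk⟩
  refine h ⟨1 - k, ?_⟩
  rw [zpow_sub₀ hq0, zpow_one, one_mul, eq_div_iff (zpow_ne_zero _ hq0), mul_comm]
  rw [one_mul] at hk
  rw [← hk, div_mul_cancel₀ _ ha0]

/-- The expansion of `1 / (a qᴺ; q)_∞` used in the Laplace sum. -/
theorem hasSum_inv_qPochInf_mul_zpow {q a : ℂ} (hq0 : q ≠ 0) (hq1 : ‖q‖ < 1) (ha0 : a ≠ 0)
    (h : a ∉ qSpiral 1 q) (N : ℤ) :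
    HasSum (fun k : ℕ => qPochInf q q / qTheta q (-a) *
        (q ^ (N * (N - 1) / 2) * (-a) ^ N * (eulerCoeff q k * (q ^ (1 - N) / a) ^ k)))
      (qPochInf (a * q ^ N) q)⁻¹ := by
  have hN := mul_zpow_notMem_qSpiral hq0 h N
  have haN : a * q ^ N ≠ 0 := mul_ne_zero ha0 (zpow_ne_zero _ hq0)
  have h1 := qTheta_mul_zpow hq0 (neg_ne_zero.2 ha0) N
  have h2 := qTheta_neg hq0 hq1 haN
  have h3 := qTheta_neg_ne_zero hq0 hq1 ha0 h
  have h4 := qPochInf_ne_zero_of_notMem_qSpiral hq1 hN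
  have h5 : q / (a * q ^ N) = q ^ (1 - N) / a := by
    rw [zpow_sub₀ hq0, zpow_one, div_div, mul_comm a]
  rw [neg_mul_eq_neg_mul, h5] at h2
  rw [h2] at h1
  have h6 : (qPochInf (a * q ^ N) q)⁻¹ = qPochInf q q / qTheta q (-a) *
      (q ^ (N * (N - 1) / 2) * (-a) ^ N * qPochInf (q ^ (1 - N) / a) q) := by
    field_simp
    linear_combination -h1
  rw [h6]
  exact ((hasSum_eulerCoeff hq1 _).mul_left _).mul_left _

/-! ### The series `Φ_j` -/

theorem prod_map_range' (f : ℕ → ℂ) (a r : ℕ) :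
    ((List.range' a r).map f).prod = ∏ i ∈ Finset.range r, f (a + i) := by
  induction r with
  | zero => simp
  | succ r ih => rw [List.range'_1_concat, List.map_append, List.prod_append, ih,
      Finset.prod_range_succ]; simp

/-- After the first `j` factors, each block of `r` consecutive factors contributes one to each
residue class modulo `r`. -/
theorem qPoch_self_add_mul (q : ℂ) (r j n : ℕ) :
    qPoch q q (j + r * n) =
      qPoch q q j * ∏ i ∈ Finset.range r, qPoch (q ^ (j + 1 + i)) (q ^ r) n := by
  induction n with
  | zero => simp [qPoch]
  | succ n ih =>
    rw [mul_add_one, ← add_assoc, qPoch_add, ih, mul_assoc, ← Finset.prod_mul_distrib]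
    congr 1
    refine Finset.prod_congr rfl fun i _ => ?_
    rw [qPoch_succ, ← pow_mul]
    congr 2
    ring

/-- The omitted parameter `q^r` is restored by the factor `(q^r;q^r)_n` built into the
hypergeometric coefficient, so the denominator is a full set of residue classes and collapses to one
`q`-factorial. -/
theorem qHypCoeff_erase {q : ℂ} (hq1 : ‖q‖ < 1) {r j : ℕ} (hj : j < r) (n : ℕ) :
    qHypCoeff (List.replicate (r - 1) 0)
        (((List.range' (j + 1) r).erase r).map fun i => q ^ i) (q ^ r) n =
      (-1) ^ n * q ^ (r * (n * (n - 1) / 2)) * qPoch q q j / qPoch q q (j + r * n) := by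
  have hmem : r ∈ List.range' (j + 1) r := by rw [List.mem_range'_1]; omega
  have h1 := List.prod_map_erase (fun i => qPoch (q ^ i) (q ^ r) n) hmem
  rw [prod_map_range'] at h1
  have h2 := qPoch_self_add_mul q r j n
  have h3 := qPoch_self_ne_zero hq1 j
  rw [← h1] at h2
  have hlen : (((List.range' (j + 1) r).erase r).map fun i => q ^ i).length = r - 1 := by
    rw [List.length_map, List.length_erase_of_mem hmem, List.length_range']
  rw [qHypCoeff, hlen, List.length_replicate, add_sub_cancel_right, zpow_one, List.map_map, h2,
    pow_mul]
  have h4 : (List.map (fun c : ℂ => qPoch c (q ^ r) n) (List.replicate (r - 1) 0)).prod = 1 := by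
    simp [qPoch]
  rw [h4, mul_comm (qPoch (q ^ r) (q ^ r) n), mul_comm (qPoch q q j), mul_div_mul_right _ _ h3]
  simp only [Function.comp_def]
  ring

theorem summable_qHypCoeff_erase {q : ℂ} (hq1 : ‖q‖ < 1) {r j : ℕ} (hj : j < r) (z : ℂ) :
    Summable fun n : ℕ => qHypCoeff (List.replicate (r - 1) 0)
        (((List.range' (j + 1) r).erase r).map fun i => q ^ i) (q ^ r) n * z ^ n := by
  simp only [qHypCoeff_erase hq1 hj]
  refine summable_of_succ_eq_mul
    (d := fun n => -z * (q ^ r) ^ n * (qPoch q q (j + r * n) / qPoch q q (j + r * (n + 1))))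
    (fun n => ?_) ?_
  · have h1 := qPoch_self_ne_zero hq1 (j + r * n)
    have h2 := qPoch_self_ne_zero hq1 (j + r * (n + 1))
    rw [triangular_succ]
    field_simp
    ring
  · have hr : r ≠ 0 := by omega
    have hqr : ‖q ^ r‖ < 1 := by
      rw [norm_pow]; exact pow_lt_one₀ (norm_nonneg _) hq1 hr
    have h1 : Tendsto (fun n : ℕ => j + r * n) atTop atTop :=
      tendsto_atTop_mono (fun n => (Nat.le_mul_of_pos_left n (Nat.pos_of_ne_zero hr)).trans
        (Nat.le_add_left _ _)) tendsto_id
    have h2 := (tendsto_qPoch hq1 q).comp h1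
    have h3 := h2.div ((tendsto_add_atTop_iff_nat 1).2 h2) (qPochInf_self_ne_zero hq1)
    simpa using ((tendsto_pow_zero_of_norm_lt_one hqr).const_mul (-z)).mul h3

/-! ### The double series -/

/-- The term of index `(n, k)` of the double series obtained by expanding each term of the
Laplace sum. -/
noncomputable def laplaceTerm (q a w : ℂ) (s : ℕ) (t : ℤ × ℕ) : ℂ :=
  q ^ (s * (t.1 * (t.1 - 1) / 2) + s * t.1 * (s * t.1 - 1) / 2) * w ^ t.1 *
    (eulerCoeff q t.2 * (q ^ (1 - s * t.1) / a) ^ t.2)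

/-- The quadratic part of the exponent in `(N, k)` is `s(s+1)N²/2 - sNk + k²/2`. At `N = n + m`, `k
= j + (s+1)m` the `nm` terms cancel, leaving `s(s+1)n²/2` and `(s+1)m²/2`: the bases of the theta
function and of `Φ_j`. -/
theorem laplaceTerm_shear {q a w : ℂ} (hq0 : q ≠ 0) (hq1 : ‖q‖ < 1) (ha : a ≠ 0) (hw : w ≠ 0)
    {s j : ℕ} (hj : j < s + 1) (n : ℤ) (m : ℕ) :
    laplaceTerm q a w s (n + m, j + (s + 1) * m) =
      eulerCoeff q j * (q / a) ^ j *
        (((q ^ ((s + 1) * s)) ^ (n * (n - 1) / 2) *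
            (q ^ ((s : ℤ) * (s - 1) / 2 - s * j) * w) ^ n) *
          (qHypCoeff (List.replicate s 0)
              (((List.range' (j + 1) (s + 1)).erase (s + 1)).map fun i => q ^ i) (q ^ (s + 1)) m *
            ((-1) ^ s * w / a ^ (s + 1) * q ^ (j + 1)) ^ m)) := by
  have hexp : (s * ((n + m) * (n + m - 1) / 2) + s * (n + m) * (s * (n + m) - 1) / 2) +
      (((j + (s + 1) * m : ℕ) : ℤ) * (((j + (s + 1) * m : ℕ) : ℤ) - 1) / 2 +
        (1 - s * (n + m)) * ((j + (s + 1) * m : ℕ) : ℤ)) =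
      ((j : ℤ) * (j - 1) / 2 + j) + (((s + 1) * s : ℕ) * (n * (n - 1) / 2) +
        ((s : ℤ) * (s - 1) / 2 - s * j) * n +
        ((s + 1 : ℕ) * ((m : ℤ) * (m - 1) / 2) + (j + 1 : ℕ) * m)) := by
    have h1 := two_mul_triangular (n + m)
    have h2 := two_mul_triangular (s * (n + m))
    have h3 := two_mul_triangular (j + (s + 1) * m : ℕ)
    have h4 := two_mul_triangular j
    have h5 := two_mul_triangular n
    have h6 := two_mul_triangular s
    have h7 := two_mul_triangular m
    refine mul_left_cancel₀ (two_ne_zero (α := ℤ)) ?_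
    push_cast at *
    linear_combination (s : ℤ) * h1 + h2 + h3 - h4 - ((s + 1) * s : ℤ) * h5 - n * h6 -
      (s + 1 : ℤ) * h7
  have hpow : q ^ (s * ((n + m) * (n + m - 1) / 2) + s * (n + m) * (s * (n + m) - 1) / 2) *
      (q ^ ((j + (s + 1) * m) * (j + (s + 1) * m - 1) / 2) *
        (q ^ (1 - s * (n + m))) ^ (j + (s + 1) * m)) =
      q ^ (j * (j - 1) / 2) * q ^ j * ((q ^ ((s + 1) * s)) ^ (n * (n - 1) / 2) *
        (q ^ ((s : ℤ) * (s - 1) / 2 - s * j)) ^ n *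
        (q ^ ((s + 1) * (m * (m - 1) / 2)) * (q ^ (j + 1)) ^ m)) := by
    simp only [← zpow_natCast, ← zpow_mul, ← zpow_add₀ hq0]
    congr 1
    rw [Nat.cast_mul (s + 1) (m * (m - 1) / 2), natCast_triangular, natCast_triangular,
      natCast_triangular]
    exact hexp
  have hsign : ((-1 : ℂ) ^ (j + (s + 1) * m)) = (-1) ^ j * ((-1) ^ m * ((-1) ^ s) ^ m) := by
    rw [← pow_mul]; ring
  have hak : a ^ (j + (s + 1) * m) = a ^ j * (a ^ (s + 1)) ^ m := by rw [pow_add, pow_mul]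
  have hcoeff := qHypCoeff_erase hq1 hj m
  rw [Nat.add_sub_cancel] at hcoeff
  have hj0 := qPoch_self_ne_zero hq1 j
  have hk0 := qPoch_self_ne_zero hq1 (j + (s + 1) * m)
  rw [hcoeff]
  simp only [laplaceTerm, eulerCoeff, div_pow, mul_pow, mul_zpow]
  rw [hsign, hak, zpow_add₀ hw, zpow_natCast]
  -- With the powers made opaque, only the exponent identity `hpow` and the sign remain.
  generalize q ^ (s * ((n + m) * (n + m - 1) / 2) + s * (n + m) * (s * (n + m) - 1) / 2) = A
    at hpow ⊢
  generalize q ^ ((j + (s + 1) * m) * (j + (s + 1) * m - 1) / 2) = B at hpow ⊢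
  generalize (q ^ (1 - s * (n + m))) ^ (j + (s + 1) * m) = C at hpow ⊢
  generalize (q ^ ((s + 1) * s)) ^ (n * (n - 1) / 2) = D at hpow ⊢
  generalize (q ^ ((s : ℤ) * (s - 1) / 2 - s * j)) ^ n = E at hpow ⊢
  generalize (q ^ (j + 1)) ^ m = F at hpow ⊢
  generalize q ^ ((s + 1) * (m * (m - 1) / 2)) = G at hpow ⊢
  generalize q ^ (j * (j - 1) / 2) = H at hpow ⊢
  generalize (a ^ (s + 1)) ^ m = K at hak ⊢
  generalize ((-1 : ℂ) ^ s) ^ m = M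
  have hK : K ≠ 0 := fun h => pow_ne_zero _ ha (by rw [hak, h, mul_zero])
  field_simp
  linear_combination M * hpow

/-- The sheared classes `j = 0, …, s` partition `ℤ × ℕ`, and on each the family is a product of two
summable ones; summability of the whole follows. -/
theorem hasSum_laplaceTerm {q a w : ℂ} (hq0 : q ≠ 0) (hq1 : ‖q‖ < 1) (ha : a ≠ 0) (hw : w ≠ 0)
    {s : ℕ} (hs : s ≠ 0) :
    HasSum (laplaceTerm q a w s) (∑ j ∈ Finset.range (s + 1), eulerCoeff q j * (q / a) ^ j *
      (qTheta (q ^ ((s + 1) * s)) (q ^ ((s : ℤ) * (s - 1) / 2 - s * j) * w) *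
        qHyp (List.replicate s 0)
          (((List.range' (j + 1) (s + 1)).erase (s + 1)).map fun i => q ^ i) (q ^ (s + 1))
          ((-1) ^ s * w / a ^ (s + 1) * q ^ (j + 1)))) := by
  have hQ0 : q ^ ((s + 1) * s) ≠ 0 := pow_ne_zero _ hq0
  have hQ1 : ‖q ^ ((s + 1) * s)‖ < 1 := by
    rw [norm_pow]; exact pow_lt_one₀ (norm_nonneg _) hq1 (by positivity)
  set ι : ℕ → ℤ × ℕ → ℤ × ℕ := fun j t => (t.1 + t.2, j + (s + 1) * t.2) with hι
  have hinj : ∀ j, Function.Injective (ι j) := by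
    rintro j ⟨n, m⟩ ⟨n', m'⟩ h
    simp only [hι, Prod.mk.injEq, add_right_inj, mul_eq_mul_left_iff] at h
    obtain ⟨h1, h2 | h2⟩ := h
    · subst h2; simpa using h1
    · omega
  have hj : ∀ j ∈ Finset.range (s + 1),
      HasSum ((Set.range (ι j)).indicator (laplaceTerm q a w s)) (eulerCoeff q j * (q / a) ^ j *
        (qTheta (q ^ ((s + 1) * s)) (q ^ ((s : ℤ) * (s - 1) / 2 - s * j) * w) *
        qHyp (List.replicate s 0)
          (((List.range' (j + 1) (s + 1)).erase (s + 1)).map fun i => q ^ i) (q ^ (s + 1))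
          ((-1) ^ s * w / a ^ (s + 1) * q ^ (j + 1)))) := fun j hj => by
    have hj' := Finset.mem_range.1 hj
    refine ((hinj j).hasSum_iff fun t ht => Set.indicator_of_notMem ht _).1 ?_
    refine ((hasSum_mul_of_summable (summable_qTheta hQ0 hQ1 _)
      (summable_qHypCoeff_erase hq1 hj' _)).mul_left (eulerCoeff q j * (q / a) ^ j)).congr_fun
        fun t => ?_
    rw [Function.comp, Set.indicator_of_mem (Set.mem_range_self t)]
    exact laplaceTerm_shear hq0 hq1 ha hw hj' t.1 t.2
  refine (hasSum_sum hj).congr_fun ?_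
  rintro ⟨n, k⟩
  -- Division with remainder of `k` by `s + 1` picks out the only class containing `(n, k)`.
  rw [Finset.sum_eq_single (k % (s + 1)), Set.indicator_of_mem]
  · refine ⟨(n - (k / (s + 1) : ℕ), k / (s + 1)), ?_⟩
    simp only [hι, Nat.mod_add_div, sub_add_cancel]
  · rintro j hj hne
    refine Set.indicator_of_notMem ?_ _
    rintro ⟨⟨n', m'⟩, h⟩
    refine hne ?_
    have h' : j + (s + 1) * m' = k := congrArg Prod.snd h
    rw [← h', Nat.add_mul_mod_self_left]
    exact (Nat.mod_eq_of_lt (Finset.mem_range.1 hj)).symm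
  · exact fun h => absurd (Finset.mem_range.2 (Nat.mod_lt _ s.succ_pos)) h

/-! ### The resummation -/

theorem isMeromorphicSumOf_inv_qPochInf {q σ : ℂ} (hq1 : ‖q‖ < 1) {F : PowerSeries ℂ}
    (hF : ∀ n, PowerSeries.coeff n F = σ ^ n / qPoch q q n) :
    IsMeromorphicSumOf F fun ξ => (qPochInf (σ * ξ) q)⁻¹ := by
  refine ⟨fun z _ => ?_, ?_⟩
  · have : Differentiable ℂ fun ξ => qPochInf (σ * ξ) q :=
      (differentiable_qPochInf hq1).comp (differentiable_id.const_mul σ)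
    exact (this.analyticAt z).meromorphicAt.inv
  · have h : Tendsto (fun ξ : ℂ => ‖σ * ξ‖) (𝓝 0) (𝓝 0) := by
      have : Continuous fun ξ : ℂ => ‖σ * ξ‖ := by fun_prop
      simpa using this.tendsto 0
    filter_upwards [h.eventually (gt_mem_nhds one_pos)] with ξ hξ
    refine (hasSum_inv_qPoch hq1 hξ).congr_fun fun n => ?_
    rw [hF, mul_pow]
    ring

theorem hasBorelLaplaceSum_of_coeff {q σ lam x : ℂ} (hq0 : q ≠ 0) (hq1 : ‖q‖ < 1) {s : ℕ}
    (hs : s ≠ 0) (hσ : σ ≠ 0) (hlam : lam ≠ 0) (hx : x ≠ 0) (hxs : x ∉ qSpiral (-lam) (q ^ s))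
    (ha : σ * lam ∉ qSpiral 1 q) {f : PowerSeries ℂ}
    (hf : ∀ n, PowerSeries.coeff n (qBorel (q ^ s) f) = σ ^ n / qPoch q q n) :
    HasBorelLaplaceSum (q ^ s) lam f x
      (qPochInf q q / (qTheta (q ^ s) (lam / x) * qTheta q (-(σ * lam))) *
        ∑ j ∈ Finset.range (s + 1), eulerCoeff q j * (q / (σ * lam)) ^ j *
          (qTheta (q ^ ((s + 1) * s))
              (q ^ ((s : ℤ) * (s - 1) / 2 - s * j) * (lam / x * (-(σ * lam)) ^ s)) *
            qHyp (List.replicate s 0)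
              (((List.range' (j + 1) (s + 1)).erase (s + 1)).map fun i => q ^ i) (q ^ (s + 1))
              ((-1) ^ s * (lam / x * (-(σ * lam)) ^ s) / (σ * lam) ^ (s + 1) * q ^ (j + 1)))) := by
  have hp0 : q ^ s ≠ 0 := pow_ne_zero _ hq0
  have hp1 : ‖q ^ s‖ < 1 := by rw [norm_pow]; exact pow_lt_one₀ (norm_nonneg _) hq1 hs
  have ha0 : σ * lam ≠ 0 := mul_ne_zero hσ hlam
  -- `θ_p` is nonzero off `[-1;p]`, and `λ p^n / x` in that spiral would force `x ∈ [-λ;p]`.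
  have hne : ∀ n : ℤ, qTheta (q ^ s) (lam * (q ^ s) ^ n / x) ≠ 0 := fun n => by
    have h := qTheta_neg_ne_zero hp0 hp1 (a := -(lam * (q ^ s) ^ n / x))
      (neg_ne_zero.2 (div_ne_zero (mul_ne_zero hlam (zpow_ne_zero _ hp0)) hx)) ?_
    · rwa [neg_neg] at h
    · rintro ⟨k, hk⟩
      refine hxs ⟨n - k, ?_⟩
      rw [zpow_sub₀ hp0]
      have := zpow_ne_zero k hp0
      field_simp at hk ⊢
      linear_combination -hk
  have hmero := isMeromorphicSumOf_inv_qPochInf hq1 hf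
  have harg : ∀ n : ℤ, σ * (lam * (q ^ s) ^ n) = σ * lam * q ^ (s * n) := fun n => by
    rw [zpow_mul, zpow_natCast, mul_assoc]
  refine ⟨_, hmero, fun n => ?_, hne, ?_⟩
  · have hd : Differentiable ℂ fun ξ => qPochInf (σ * ξ) q :=
      (differentiable_qPochInf hq1).comp (differentiable_id.const_mul σ)
    refine (hd.analyticAt _).inv ?_
    rw [harg]
    exact qPochInf_ne_zero_of_notMem_qSpiral hq1 (mul_zpow_notMem_qSpiral hq0 ha _)
  -- This is the base `w` of `laplaceTerm`: `(λ/x)^n` comes from `θ_p(λ p^n / x)` and `(-a)^(sn)`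
  -- from `θ_q(-a q^(sn))`.
  · have hw : lam / x * (-(σ * lam)) ^ s ≠ 0 :=
      mul_ne_zero (div_ne_zero hlam hx) (pow_ne_zero _ (neg_ne_zero.2 ha0))
    have h1 := (hasSum_laplaceTerm hq0 hq1 ha0 hw hs).mul_left
      (qPochInf q q / (qTheta (q ^ s) (lam / x) * qTheta q (-(σ * lam))))
    -- Summing over `k` inside the convergent double series gives unconditional convergence of the
    -- Laplace sum together with its value.
    refine h1.prod_fiberwise fun n => ?_
    beta_reduce
    rw [harg]
    have h2 := qTheta_mul_zpow hp0 (div_ne_zero hlam hx) n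
    rw [div_mul_eq_mul_div] at h2
    have h3 := hne 0
    rw [zpow_zero, mul_one] at h3
    have h4 := qTheta_neg_ne_zero hq0 hq1 ha0 ha
    refine ((hasSum_inv_qPochInf_mul_zpow hq0 hq1 ha0 ha (s * n)).div_const _).congr_fun
      fun k => ?_
    have h5 := hne n
    rw [← h2]
    rw [← h2] at h3
    have h6 : (-(σ * lam)) ^ ((s : ℤ) * n) = ((-(σ * lam)) ^ s) ^ n := by
      rw [zpow_mul, zpow_natCast]
    have h7 : q ^ ((s : ℤ) * (n * (n - 1) / 2)) = (q ^ s) ^ (n * (n - 1) / 2) := by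
      rw [zpow_mul, zpow_natCast]
    simp only [laplaceTerm]
    rw [zpow_add₀ hq0, h6, h7, mul_zpow (lam / x)]
    have h8 := zpow_ne_zero (n * (n - 1) / 2) hp0
    have h9 := zpow_ne_zero n (div_ne_zero hlam hx)
    field_simp

/-- For a sign `σ`, `σ⁻¹ = σ` brings the general formula to a shape covering both cases. -/
theorem hasBorelLaplaceSum_of_mul_self_eq_one {q σ lam x : ℂ} (hq0 : q ≠ 0) (hq1 : ‖q‖ < 1)
    {s : ℕ} (hs : s ≠ 0) (hσ : σ * σ = 1) (hlam : lam ≠ 0) (hx : x ≠ 0)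
    (hxs : x ∉ qSpiral (-lam) (q ^ s)) (ha : lam ∉ qSpiral σ q) {f : PowerSeries ℂ}
    (hf : ∀ n, PowerSeries.coeff n (qBorel (q ^ s) f) = σ ^ n / qPoch q q n) :
    HasBorelLaplaceSum (q ^ s) lam f x
      (∑ j ∈ Finset.range (s + 1),
        qTheta (q ^ ((s + 1) * s))
            ((-σ) ^ s * q ^ ((s : ℤ) * (s - 1) / 2 - s * j) * (lam ^ (s + 1) / x)) /
          (qTheta (q ^ s) (lam / x) * qTheta q (-σ * lam)) * qPochInf q q *
          ((-σ) ^ j * q ^ (j * (j - 1) / 2) / qPoch q q j * (q / lam) ^ j) *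
          qHyp (List.replicate s 0)
            (((List.range' (j + 1) (s + 1)).erase (s + 1)).map fun i => q ^ i) (q ^ (s + 1))
            (σ * q ^ (j + 1) / x)) := by
  have hσ0 : σ ≠ 0 := left_ne_zero_of_mul_eq_one hσ
  have ha' : σ * lam ∉ qSpiral 1 q := by
    rintro ⟨k, hk⟩
    exact ha ⟨k, by linear_combination σ * hk - lam * hσ⟩
  have h := hasBorelLaplaceSum_of_coeff hq0 hq1 hs hσ0 hlam hx hxs ha' hf
  rw [Finset.mul_sum] at h
  convert h using 2 with j hj
  have hinv : q / (σ * lam) = σ * (q / lam) := by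
    field_simp
    linear_combination -hσ
  have hw : lam / x * (-(σ * lam)) ^ s = (-σ) ^ s * (lam ^ (s + 1) / x) := by
    rw [neg_mul_eq_neg_mul, mul_pow]; ring
  have hz : (-1) ^ s * (lam / x * (-(σ * lam)) ^ s) / (σ * lam) ^ (s + 1) * q ^ (j + 1) =
      σ * q ^ (j + 1) / x := by
    have h1 : (-1 : ℂ) ^ s * (-(σ * lam)) ^ s = (σ * lam) ^ s := by
      rw [← mul_pow, neg_one_mul, neg_neg]
    rw [mul_left_comm, h1, pow_succ]
    field_simp
    linear_combination -hσ
  rw [hz, hinv, hw, neg_mul_eq_neg_mul, mul_pow, neg_pow σ j, eulerCoeff, mul_left_comm _ ((-σ) ^ s),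
    ← mul_assoc ((-σ) ^ s)]
  ring

theorem coeff_qBorel_qHypSeries {q : ℂ} (hq0 : q ≠ 0) (s n : ℕ) :
    PowerSeries.coeff n (qBorel (q ^ s) (qHypSeries (List.replicate (s + 1) 0) [] q)) =
      ((-1) ^ s) ^ n / qPoch q q n := by
  have h4 : (List.map (fun c : ℂ => qPoch c q n) (List.replicate (s + 1) 0)).prod = 1 := by
    simp [qPoch]
  have h5 : (1 + ((([] : List ℂ).length : ℕ) : ℤ) - ((List.replicate (s + 1) (0 : ℂ)).length : ℤ)) =
      -(s : ℤ) := by simp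
  rw [qBorel, PowerSeries.coeff_mk, qHypSeries, PowerSeries.coeff_mk, qHypCoeff, h4, h5,
    zpow_neg, zpow_natCast, mul_pow, ← pow_mul, ← pow_mul, ← pow_mul, ← pow_mul, mul_comm n s,
    mul_comm (n * (n - 1) / 2) s]
  have h6 : ((-1 : ℂ) ^ (s * n))⁻¹ = (-1) ^ (s * n) := by rw [← inv_pow]; norm_num
  have h7 := pow_ne_zero (s * (n * (n - 1) / 2)) hq0
  rw [mul_inv, h6, List.map_nil, List.prod_nil]
  field_simp

theorem mainTheorem3 (q : ℂ) (hq0 : q ≠ 0) (hq1 : ‖q‖ < 1) (r : ℕ) (hr : 2 ≤ r)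
    (lam x : ℂ) (hlam : lam ≠ 0) (hx : x ≠ 0) (hxs : x ∉ qSpiral (-lam) (q ^ (r - 1))) :
    -- the series on the right-hand sides converge everywhere
    (∀ j < r, ∀ z : ℂ, Summable fun n : ℕ =>
      qHypCoeff (List.replicate (r - 1) 0)
        (((List.range' (j + 1) r).erase r).map fun i => q ^ i) (q ^ r) n * z ^ n) ∧
    -- resummation of the series at `x`
    (lam ∉ qSpiral ((-1) ^ (r - 1)) q →
      HasBorelLaplaceSum (q ^ (r - 1)) lam (qHypSeries (List.replicate r 0) [] q) x
        (∑ j ∈ Finset.range r,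
          qTheta (q ^ (r * (r - 1)))
              (q ^ (((r : ℤ) - 1) * ((r : ℤ) - 2) / 2 - ((r : ℤ) - 1) * (j : ℤ)) * (lam ^ r / x)) /
            (qTheta (q ^ (r - 1)) (lam / x) * qTheta q ((-1) ^ r * lam)) *
          qPochInf q q *
          ((-1) ^ (r * j) * q ^ (j * (j - 1) / 2) / qPoch q q j * (q / lam) ^ j) *
          qHyp (List.replicate (r - 1) 0)
            (((List.range' (j + 1) r).erase r).map fun i => q ^ i) (q ^ r)
            ((-1) ^ (r - 1) * q ^ (j + 1) / x))) ∧
    -- resummation of the series at `(-1) ^ (r - 1) * x`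
    (lam ∉ qSpiral 1 q →
      HasBorelLaplaceSum (q ^ (r - 1)) lam
        (PowerSeries.rescale ((-1 : ℂ) ^ (r - 1)) (qHypSeries (List.replicate r 0) [] q)) x
        (∑ j ∈ Finset.range r,
          qTheta (q ^ (r * (r - 1)))
              ((-1) ^ (r - 1) *
                q ^ (((r : ℤ) - 1) * ((r : ℤ) - 2) / 2 - ((r : ℤ) - 1) * (j : ℤ)) *
                (lam ^ r / x)) /
            (qTheta (q ^ (r - 1)) (lam / x) * qTheta q (-lam)) *
          qPochInf q q *
          ((-1) ^ j * q ^ (j * (j - 1) / 2) / qPoch q q j * (q / lam) ^ j) *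
          qHyp (List.replicate (r - 1) 0)
            (((List.range' (j + 1) r).erase r).map fun i => q ^ i) (q ^ r)
            (q ^ (j + 1) / x))) := by
  obtain ⟨s, rfl⟩ : ∃ s, r = s + 1 := ⟨r - 1, by omega⟩
  have hs : s ≠ 0 := by omega
  have hε : ((-1 : ℂ) ^ s) * (-1) ^ s = 1 := by rw [← mul_pow]; norm_num
  have e1 : (((s + 1 : ℕ) : ℤ) - 1) = s := by push_cast; ring
  have e2 : (((s + 1 : ℕ) : ℤ) - 2) = s - 1 := by push_cast; ring
  refine ⟨fun j hj z => summable_qHypCoeff_erase hq1 hj z, fun h => ?_, fun h => ?_⟩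
  · have hmain := hasBorelLaplaceSum_of_mul_self_eq_one hq0 hq1 hs hε hlam hx hxs h
      (coeff_qBorel_qHypSeries hq0 s)
    have h1 : -(-1 : ℂ) ^ s = (-1) ^ (s + 1) := by ring
    -- Since `s(s+1)` is even, no sign survives in the theta argument of (i).
    have h2 : ((-1 : ℂ) ^ (s + 1)) ^ s = 1 := by
      rw [← pow_mul, mul_comm]
      exact (Nat.even_mul_succ_self s).neg_one_pow
    simp only [h1, h2, one_mul, ← pow_mul] at hmain
    simpa only [e1, e2, Nat.add_sub_cancel] using hmain
  -- Rescaling by `ε` cancels the sign `ε^n` of the Borel coefficients, so `σ = 1`.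
  · have hmain := hasBorelLaplaceSum_of_mul_self_eq_one hq0 hq1 hs (one_mul 1) hlam hx hxs h
      (f := PowerSeries.rescale ((-1 : ℂ) ^ s) (qHypSeries (List.replicate (s + 1) 0) [] q))
      fun n => by
        have h1 := coeff_qBorel_qHypSeries hq0 s n
        simp only [qBorel, PowerSeries.coeff_mk, PowerSeries.coeff_rescale] at h1 ⊢
        rw [mul_assoc, h1, ← mul_div_assoc, ← mul_pow, hε]
    simp only [one_mul, neg_one_mul] at hmain
    simpa only [e1, e2, Nat.add_sub_cancel] using hmain
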